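/- Let $L\ge 0$ be an integer, $\gamma\in\mathbb C$, $u=(u_1,\dots,u_L)\in\mathbb C^L$, $m=(m_1,\dots,m_L)\in\mathbb C^L$, and write $u_{a,b}=u_a-u_b$, $m_{a,b}=m_a-m_b$. For $k\le L$, positions $I=(I_1<\dots<I_k)$ in $\{1,\dots,L\}$ and $u_1,\dots,u_k$, let $$\psi_I(u;m)=\sum_{\sigma\in\mathfrak S_k}\ f_I(u_{\sigma(1)},\dots,u_{\sigma(k)}),\qquad f_I(u)=\frac{\prod_{a=1}^k\Big(\prod_{i=1}^{I_a-1}(u_a-m_i-\frac\gamma2)\prod_{i=I_a+1}^{L}(-u_a+m_i-\frac\gamma2)\Big)}{\prod_{1\le a<b\le k}u_{b,a}\,(u_{a,b}+\gamma)}$$ be the $A_1$ orbifold defect, let $$\widehat\psi_I(u;m)=(-1)^{kL+\sum_a I_a}\prod_{1\le a<b\le k}(\gamma^2-u_{a,b}^2)\;\psi_I(u;m)$$ be the normalized defect, and let $\widehat{\mathcal Z}_k(u;m)=\sum_{I}\widehat\psi_I(u;m)$, the sum over all such $I$. Take $k=L$ and assume that $u_{a,b}\neq0$ and $u_{a,b}+\gamma\ne0$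 for all $a\neq b$, so that all denominators in $\widehat{\mathcal Z}_L$ are nonzero. Then: (1) (Izergin determinant) If $m_{a,b}\ne0$ for all $a\ne b$, and $u_a-m_b-\frac\gamma2\ne0$ and $u_a-m_b+\frac\gamma2\neq0$ for all $a,b$, then $$\widehat{\mathcal Z}_L(u;m)=\frac{\prod_{a,b=1}^L(u_a-m_b-\frac\gamma2)(u_a-m_b+\frac\gamma2)}{\prod_{a<b}u_{b,a}\,m_{a,b}}\ \det\left(\frac1{(u_a-m_b-\frac\gamma2)(u_a-m_b+\frac\gamma2)}\right)_{a,b=1,\dots,L}.$$ (2) (Kostov determinant) If $u_a-m_b+\frac\gamma2\neq0$ for all $a,b$, then $$(-\gamma)^L\,\widehat{\mathcal Z}_L(u;m)=\frac{\prod_{a,b=1}^L(u_a-m_b+\frac\gamma2)}{\prod_{a<b}u_{b,a}}\ \det\left(u_a^{b-1}\prod_{i=1}^L\frac{u_a-m_i-\frac\gamma2}{u_a-m_i+\frac\gamma2}-(u_a-\gamma)^{b-1}\right)_{a,b=1,\dots,L}.$$ (3) (Domain wall partition function) $\gamma^L\,\widehat{\mathcal Z}_L(u;m)$ is the domain wall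 partition function of the rational $\mathfrak{su}(2)$ six-vertex model on the $L\times L$ square lattice with rapidities $x_a=u_a-\frac\gamma2$ on the rows and inhomogeneities $y_b=m_b$ on the columns. This is the sum, over all assignments of colours $1,2$ to the bonds with colour $1$ on all left and top boundary bonds and colour $2$ on all right and bottom boundary bonds, of the product over all vertices of the following weights: a vertex on lines with variables $x$ and $y$ has weight $x-y+\gamma$ if its four bonds have the same colour; $x-y$ if its left and right bonds have one colour and its bottom and top bonds have the other colour; $\gamma$ if its left and top bonds have one colour and its bottom and right bonds have the other colour; and $0$ otherwise. In particular, for $\gamma=1$ (weights $x-y+1$, $x-y$, $1$), $\widehat{\mathcal Z}_L(u;m)$ is itself the domain wall partition function. -/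

import Mathlib

open Finset

noncomputable section

namespace OrbifoldDefect

/-- The symmetrization `Sym_u f (u) = ∑_{σ ∈ S_k} f (u_{σ(1)}, …, u_{σ(k)})`. -/
def symmetrize {k : ℕ} (f : (Fin k → ℂ) → ℂ) (u : Fin k → ℂ) : ℂ :=
  ∑ σ : Equiv.Perm (Fin k), f (fun a => u (σ a))

/-- The orbifold defect `ψ_I^{(L)}(u; m)` of the `A_1` quiver, for twisted masses `m_1, …, m_L`, `γ`,
vector multiplet scalars `u_1, …, u_k` and a `k`-tuple of positions `I_1 < … < I_k`. -/
def psi {k L : ℕ} (γ : ℂ) (I : Fin k → Fin L) (m : Fin L → ℂ) (u : Fin k → ℂ) : ℂ :=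
  symmetrize
    (fun w =>
      (∏ a, ((∏ i ∈ Iio (I a), (w a - m i - γ / 2)) * ∏ i ∈ Ioi (I a), (-w a + m i - γ / 2))) /
        ∏ a, ∏ b ∈ Ioi a, ((w b - w a) * (w a - w b + γ)))
    u

/-- The normalized orbifold defect: `ψ` multiplied by
`(-1)^{kL + ∑ I_a} ∏_{a<b} (γ² - (u_a - u_b)²)`. The elements of `Fin L` start at `0`, so that the
position `I_a ∈ {1, …, L}` is `(I a : ℕ) + 1`. -/
def psiHat {k L : ℕ} (γ : ℂ) (I : Fin k → Fin L) (m : Fin L → ℂ) (u : Fin k → ℂ) : ℂ :=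
  (-1) ^ (k * L + ∑ a, ((I a : ℕ) + 1)) *
    (∏ a, ∏ b ∈ Ioi a, (γ ^ 2 - (u a - u b) ^ 2)) * psi γ I m u

open Classical in
/-- The partition function `Ẑ_k(u_k; m_L)`: the sum of the normalized defects over all
`I_1 < … < I_k` in `{1, …, L}`. -/
def zHat {k L : ℕ} (γ : ℂ) (m : Fin L → ℂ) (u : Fin k → ℂ) : ℂ :=
  ∑ I ∈ univ.filter (fun I : Fin k → Fin L => StrictMono I), psiHat γ I m u

/-- The two colours (spin states) on the bonds of the `su(2)` six-vertex model. -/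
abbrev Colour : Type := Fin 2

/-- Colour `1`. -/
def colour1 : Colour := 0

/-- Colour `2`. -/
def colour2 : Colour := 1

/-- The weight of a vertex at which a horizontal line with rapidity `x` crosses a vertical line with
inhomogeneity `y`: type `a` (four equal colours) has weight `x - y + γ`, type `b` (different colours
going straight through) `x - y`, type `c` (different colours, both turning) `γ`; all other
vertices violate colour conservation and have weight `0`.
For `γ = 1` the weights are `x - y + 1`, `x - y`, `1`. -/
def vertexWeight (γ x y : ℂ) (left bottom right top : Colour) : ℂ :=
  if left = right ∧ bottom = top then
    if left = bottom then x - y + γ else x - y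
  else if left = top ∧ bottom = right then γ
  else 0

/-- An assignment of colours to the bonds of the `L × L` lattice. `c.1 i j` is the horizontal bond of
row `i` to the left of column `j` (to the right of the last column if `j = L`), and `c.2 i j` is
the vertical bond of column `j` below row `i` (above the last row if `i = L`). Rows are counted from
bottom to top, columns from left to right. -/
abbrev Configuration (L : ℕ) : Type :=
  (Fin L → Fin (L + 1) → Colour) × (Fin (L + 1) → Fin L → Colour)

/-- Domain wall boundary conditions: colour `1` on the left and top boundaries, colour `2` on the
right and bottom boundaries. -/
def IsDomainWall {L : ℕ} (c : Configuration L) : Prop :=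
  (∀ i, c.1 i 0 = colour1) ∧ (∀ i, c.1 i (Fin.last L) = colour2) ∧
    (∀ j, c.2 0 j = colour2) ∧ (∀ j, c.2 (Fin.last L) j = colour1)

open Classical in
/-- The domain wall partition function of the rational `su(2)` six-vertex model with rapidities `x`
(rows) and inhomogeneities `y` (columns): the sum over all configurations with domain
wall boundary conditions of the product of the weights of all vertices. -/
def dwpf {L : ℕ} (γ : ℂ) (x y : Fin L → ℂ) : ℂ :=
  ∑ c ∈ univ.filter (fun c : Configuration L => IsDomainWall c),
    ∏ i : Fin L, ∏ j : Fin L,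
      vertexWeight γ (x i) (y j)
        (c.1 i j.castSucc) (c.2 i.castSucc j) (c.1 i j.succ) (c.2 i.succ j)

/-- The Izergin determinant with its prefactor. -/
def izergin {L : ℕ} (γ : ℂ) (m u : Fin L → ℂ) : ℂ :=
  (∏ a, ∏ b, ((u a - m b - γ / 2) * (u a - m b + γ / 2))) /
      (∏ a, ∏ b ∈ Ioi a, ((u b - u a) * (m a - m b))) *
    (Matrix.of fun a b : Fin L => 1 / ((u a - m b - γ / 2) * (u a - m b + γ / 2))).det

/-- The Kostov determinant with its prefactor. The column index `b : Fin L` starts at `0`, so that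
the exponent is `b`. -/
def kostov {L : ℕ} (γ : ℂ) (m u : Fin L → ℂ) : ℂ :=
  (∏ a, ∏ b, (u a - m b + γ / 2)) / (∏ a, ∏ b ∈ Ioi a, (u b - u a)) *
    (Matrix.of fun a b : Fin L =>
      u a ^ (b : ℕ) * (∏ i, (u a - m i - γ / 2) / (u a - m i + γ / 2)) -
        (u a - γ) ^ (b : ℕ)).det

end OrbifoldDefect

end

/-! For `k = L` the only admissible `I` is the identity, and the normalization turns the partition
function into `symSum`, a sum over permutations in the rapidities `x = u - γ/2`. Each of the three
expressions is then identified with `symSum` by induction on `L`, using Lagrange interpolation in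
the first inhomogeneity `t`.

With `L + 1` rapidities, `symSum` is symmetric in them, has degree at most `L` in `t`, and at `t = x
0` collapses to an explicit factor times its value for `L` rapidities. By symmetry this fixes it at
all `L + 1` points `t = x p`, hence everywhere (`eq_pow_mul_symSum`). Kostov's quotient and the
domain wall partition function share these properties up to a factor `-γ` resp. `γ` per step. For
Kostov the degree bound is the subtle point (`det_kostov_leadingCoeff`); for the lattice model it is
symmetry, which follows from the Yang-Baxter equation (`rowMatrix_commute`).

Izergin's determinant, with denominators cleared, has degree `2L` in `t`; the `L` missing nodes are
the other inhomogeneities, where both sides vanish (`izergin_det_eq_symSum`). -/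

namespace OrbifoldDefect

/-! ### Polynomial functions and interpolation -/

open Polynomial in
/-- `f` is a polynomial function of degree at most `n`. -/
def IsPolyLE (n : ℕ) (f : ℂ → ℂ) : Prop :=
  ∃ p : ℂ[X], p.natDegree ≤ n ∧ ∀ t, f t = p.eval t

namespace IsPolyLE

variable {n k : ℕ} {f g : ℂ → ℂ} {ι : Type*}

theorem mono (hf : IsPolyLE n f) (h : n ≤ k) : IsPolyLE k f :=
  let ⟨p, hp, hfp⟩ := hf
  ⟨p, hp.trans h, hfp⟩

theorem const (n : ℕ) (c : ℂ) : IsPolyLE n fun _ => c :=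
  ⟨Polynomial.C c, by simp, by simp⟩

theorem linear (a b : ℂ) : IsPolyLE 1 fun t => a + b * t :=
  ⟨Polynomial.C a + Polynomial.C b * Polynomial.X, by compute_degree, by simp⟩

theorem const_sub (a : ℂ) : IsPolyLE 1 fun t => a - t :=
  ⟨Polynomial.C a - Polynomial.X, by compute_degree, by simp⟩

theorem mul (hf : IsPolyLE n f) (hg : IsPolyLE k g) : IsPolyLE (n + k) fun t => f t * g t := by
  obtain ⟨p, hp, hfp⟩ := hf
  obtain ⟨q, hq, hgq⟩ := hg
  exact ⟨p * q, Polynomial.natDegree_mul_le_of_le hp hq, fun t => by simp [hfp, hgq]⟩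

theorem const_mul (c : ℂ) (hf : IsPolyLE n f) : IsPolyLE n fun t => c * f t :=
  ((const 0 c).mul hf).mono (by simp)

theorem mul_const (hf : IsPolyLE n f) (c : ℂ) : IsPolyLE n fun t => f t * c :=
  hf.mul (const 0 c)

theorem sum (s : Finset ι) {f : ι → ℂ → ℂ} (hf : ∀ i ∈ s, IsPolyLE n (f i)) :
    IsPolyLE n fun t => ∑ i ∈ s, f i t := by
  choose! p hp hfp using hf
  refine ⟨∑ i ∈ s, p i, Polynomial.natDegree_sum_le_of_forall_le s p hp, fun t => ?_⟩
  rw [Polynomial.eval_finsetSum]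
  exact sum_congr rfl fun i hi => hfp i hi t

theorem prod (s : Finset ι) {d : ι → ℕ} {f : ι → ℂ → ℂ} (hf : ∀ i ∈ s, IsPolyLE (d i) (f i)) :
    IsPolyLE (∑ i ∈ s, d i) fun t => ∏ i ∈ s, f i t := by
  choose! p hp hfp using hf
  refine ⟨∏ i ∈ s, p i, (Polynomial.natDegree_prod_le s p).trans (sum_le_sum hp), fun t => ?_⟩
  rw [Polynomial.eval_prod]
  exact prod_congr rfl fun i hi => hfp i hi t

/-- Polynomial functions of degree at most `n` that agree at more than `n` points are equal. -/
theorem eq_of_eqOn (hf : IsPolyLE n f) (hg : IsPolyLE n g) (s : Finset ℂ) (hs : n < #s)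
    (h : ∀ t ∈ s, f t = g t) : f = g := by
  obtain ⟨p, hp, hfp⟩ := hf
  obtain ⟨q, hq, hgq⟩ := hg
  have hpq : p = q := by
    refine Polynomial.eq_of_degree_sub_lt_of_eval_finset_eq s ?_ fun t ht => ?_
    · refine (Polynomial.degree_sub_le p q).trans_lt (max_lt ?_ ?_)
      · exact Polynomial.degree_le_natDegree.trans_lt (by exact_mod_cast hp.trans_lt hs)
      · exact Polynomial.degree_le_natDegree.trans_lt (by exact_mod_cast hq.trans_lt hs)
    · rw [← hfp, ← hgq, h t ht]
  ext t
  rw [hfp, hgq, hpq]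

end IsPolyLE

/-! ### The symmetrized sum and its characterization -/

/-- Rapidities at which the defects and the Yang-Baxter equation are nondegenerate. -/
def Generic {L : ℕ} (γ : ℂ) (x : Fin L → ℂ) : Prop :=
  (∀ a b, a ≠ b → x a - x b ≠ 0) ∧ ∀ a b, a ≠ b → x a - x b + γ ≠ 0

theorem Generic.comp {L K : ℕ} {γ : ℂ} {x : Fin L → ℂ} (hx : Generic γ x) {e : Fin K → Fin L}
    (he : Function.Injective e) : Generic γ (x ∘ e) :=
  ⟨fun _ _ h => hx.1 _ _ (he.ne h), fun _ _ h => hx.2 _ _ (he.ne h)⟩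

theorem Generic.injective {L : ℕ} {γ : ℂ} {x : Fin L → ℂ} (hx : Generic γ x) :
    Function.Injective x := fun a b h => by
  by_contra hab
  exact hx.1 a b hab (by rw [h, sub_self])

/-- The summand of the symmetrized form of the domain wall partition function. -/
noncomputable def symSummand {L : ℕ} (γ : ℂ) (w y : Fin L → ℂ) : ℂ :=
  ∏ a, ∏ b ∈ Ioi a, ((w b - y a) * (w a - y b + γ) * ((w b - w a + γ) / (w b - w a)))

/-- The domain wall partition function, up to a power of `γ`, as a sum over permutations. -/
noncomputable def symSum {L : ℕ} (γ : ℂ) (x y : Fin L → ℂ) : ℂ :=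
  ∑ σ : Equiv.Perm (Fin L), symSummand γ (x ∘ σ) y

theorem symSum_comp_perm {L : ℕ} (γ : ℂ) (x y : Fin L → ℂ) (σ : Equiv.Perm (Fin L)) :
    symSum γ (x ∘ σ) y = symSum γ x y :=
  Equiv.sum_comp (Equiv.mulLeft σ) fun τ => symSummand γ (x ∘ τ) y

theorem symSummand_cons {L : ℕ} (γ t : ℂ) (w : Fin (L + 1) → ℂ) (y : Fin L → ℂ) :
    symSummand γ w (Fin.cons t y) =
      (∏ i : Fin L, ((w i.succ - t) * (w 0 - y i + γ) *
        ((w i.succ - w 0 + γ) / (w i.succ - w 0)))) * symSummand γ (w ∘ Fin.succ) y := by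
  simp [symSummand, Fin.prod_univ_succ, Fin.prod_Ioi_succ]

/-- A permutation is a choice `p` of the image of `0` and a permutation `e` of the rest; the factors
involving index `0` form a product over all the others, so they do not depend on `e`. -/
theorem symSum_cons {L : ℕ} (γ t : ℂ) (x : Fin (L + 1) → ℂ) (y : Fin L → ℂ) :
    symSum γ x (Fin.cons t y) =
      ∑ p, (∏ i : Fin L, ((x (Equiv.swap 0 p i.succ) - t) * (x p - y i + γ) *
        ((x (Equiv.swap 0 p i.succ) - x p + γ) / (x (Equiv.swap 0 p i.succ) - x p)))) *
          symSum γ (x ∘ Equiv.swap 0 p ∘ Fin.succ) y := by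
  rw [symSum, ← Equiv.Perm.decomposeFin.symm.sum_comp, Fintype.sum_prod_type]
  refine sum_congr rfl fun p _ => ?_
  simp only [symSum, mul_sum, symSummand_cons, Function.comp_apply,
    Equiv.Perm.decomposeFin_symm_apply_zero, Equiv.Perm.decomposeFin_symm_apply_succ]
  refine sum_congr rfl fun e _ => ?_
  congr 1
  · simp only [prod_mul_distrib]
    rw [← Equiv.prod_comp e fun i : Fin L => x (Equiv.swap 0 p i.succ) - t,
      ← Equiv.prod_comp e fun i : Fin L => (x (Equiv.swap 0 p i.succ) - x p + γ) /
        (x (Equiv.swap 0 p i.succ) - x p)]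
  · congr 1
    ext i
    simp [Equiv.Perm.decomposeFin_symm_apply_succ]

theorem isPolyLE_symSum_cons {L : ℕ} (γ : ℂ) (x : Fin (L + 1) → ℂ) (y : Fin L → ℂ) :
    IsPolyLE L fun t => symSum γ x (Fin.cons t y) := by
  simp only [symSum_cons]
  refine .sum _ fun p _ => .mul_const ?_ _
  refine (IsPolyLE.prod univ (d := fun _ => 1) fun i _ => ?_).mono (by simp)
  refine IsPolyLE.mul_const (IsPolyLE.mul_const ?_ _) _
  exact .const_sub _

theorem symSum_cons_self {L : ℕ} {γ : ℂ} {x : Fin (L + 1) → ℂ} (hx : Generic γ x)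
    (y : Fin L → ℂ) :
    symSum γ x (Fin.cons (x 0) y) =
      (∏ i, (x 0 - y i + γ)) * (∏ i : Fin L, (x i.succ - x 0 + γ)) *
        symSum γ (x ∘ Fin.succ) y := by
  rw [symSum_cons, sum_eq_single 0]
  · have hne : ∀ i : Fin L, x i.succ - x 0 ≠ 0 := fun i => hx.1 _ _ (Fin.succ_ne_zero i)
    rw [← prod_mul_distrib]
    congr 1
    refine prod_congr rfl fun i _ => ?_
    have := hne i
    simp only [Equiv.swap_self, Equiv.refl_apply]
    field_simp
  · intro p _ hp
    obtain ⟨i, rfl⟩ := Fin.exists_succ_eq_of_ne_zero hp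
    -- For `p = i.succ` the swap sends `i.succ` to `0`, so the factor `x 0 - t` occurs and vanishes
    -- at `t = x 0`.
    rw [prod_eq_zero (mem_univ i) (by simp), zero_mul]
  · simp

/-- A family that is symmetric in the rapidities, polynomial in the first inhomogeneity and
freezes when the first rapidity and the first inhomogeneity coincide is a multiple of `symSum`. -/
theorem eq_pow_mul_symSum {γ c : ℂ} (G : ∀ {L : ℕ}, (Fin L → ℂ) → (Fin L → ℂ) → ℂ)
    (hzero : ∀ x y : Fin 0 → ℂ, G x y = 1)
    (hsymm : ∀ {L : ℕ} (x y : Fin L → ℂ), Generic γ x →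
      ∀ σ : Equiv.Perm (Fin L), G (x ∘ σ) y = G x y)
    (hpoly : ∀ {L : ℕ} (x : Fin (L + 1) → ℂ) (y : Fin L → ℂ),
      IsPolyLE L fun t => G x (Fin.cons t y : Fin (L + 1) → ℂ))
    (hrec : ∀ {L : ℕ} (x : Fin (L + 1) → ℂ) (y : Fin L → ℂ), Generic γ x →
      G x (Fin.cons (x 0) y : Fin (L + 1) → ℂ) =
        c * ((∏ i, (x 0 - y i + γ)) * ∏ i : Fin L, (x i.succ - x 0 + γ)) *
          G (x ∘ Fin.succ) y)
    {L : ℕ} (x y : Fin L → ℂ) (hx : Generic γ x) : G x y = c ^ L * symSum γ x y := by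
  induction L with
  | zero => simp [hzero, symSum, symSummand]
  | succ L ih =>
    have key : (fun t => G x (Fin.cons t (y ∘ Fin.succ) : Fin (L + 1) → ℂ)) =
        fun t => c ^ (L + 1) * symSum γ x (Fin.cons t (y ∘ Fin.succ)) := by
      refine (hpoly x _).eq_of_eqOn ((isPolyLE_symSum_cons γ x _).const_mul _)
        (univ.image x) ?_ fun t ht => ?_
      · rw [card_image_of_injective _ hx.injective]
        simp
      -- Symmetry moves `x p` to position `0`, where both recursions apply.
      · obtain ⟨p, -, rfl⟩ := mem_image.1 ht
        have hx' := hx.comp (Equiv.swap 0 p).injective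
        have h1 := hrec (x ∘ Equiv.swap 0 p) (y ∘ Fin.succ) hx'
        have h2 := symSum_cons_self hx' (y ∘ Fin.succ)
        rw [hsymm _ _ hx] at h1
        rw [symSum_comp_perm] at h2
        rw [ih _ _ (hx'.comp (Fin.succ_injective L))] at h1
        simp only [Function.comp_apply, Equiv.swap_apply_left] at h1 h2
        rw [h1, h2]
        ring
    have h := congrFun key (y 0)
    have hy : (Fin.cons (y 0) (y ∘ Fin.succ) : Fin (L + 1) → ℂ) = y := Fin.cons_self_tail y
    simpa only [hy] using h

/-! ### Reduction of the partition function to the symmetrized sum -/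

theorem prod_Iio_eq_prod_Ioi {L : ℕ} (g : Fin L → Fin L → ℂ) :
    ∏ a, ∏ i ∈ Iio a, g a i = ∏ a, ∏ b ∈ Ioi a, g b a :=
  prod_comm' (by simp)

/-- Both `g` and `f * g` are antisymmetric, so their products over pairs pick up the same sign;
dividing leaves the product of `f`. -/
theorem prod_Ioi_comp_perm_of_symm {L : ℕ} {f g : Fin L → Fin L → ℂ}
    (hf : ∀ a b, f a b = f b a) (hg : ∀ a b, g a b = -g b a) (hg0 : ∀ a b, a ≠ b → g a b ≠ 0)
    (σ : Equiv.Perm (Fin L)) :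
    ∏ a, ∏ b ∈ Ioi a, f (σ a) (σ b) = ∏ a, ∏ b ∈ Ioi a, f a b := by
  have h1 := σ.prod_Ioi_comp_eq_sign_mul_prod hg
  have h2 := σ.prod_Ioi_comp_eq_sign_mul_prod (f := fun a b => f a b * g a b)
    fun a b => by rw [hf, hg, mul_neg]
  simp only [prod_mul_distrib] at h2
  rw [h1] at h2
  have h3 : ∏ a, ∏ b ∈ Ioi a, g a b ≠ 0 :=
    prod_ne_zero_iff.2 fun a _ => prod_ne_zero_iff.2 fun b hb => hg0 _ _ (mem_Ioi.1 hb).ne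
  have h4 : ((σ.sign : ℤ) : ℂ) ≠ 0 := by
    rcases Int.units_eq_one_or σ.sign with h | h <;> simp [h]
  refine mul_right_cancel₀ (mul_ne_zero h4 h3) ?_
  rw [h2]
  ring

theorem neg_one_pow_mul_prod_Ioi (L : ℕ) :
    (-1 : ℂ) ^ (L * L + ∑ a : Fin L, ((a : ℕ) + 1)) * ∏ a : Fin L, ∏ _b ∈ Ioi a, (-1 : ℂ) = 1 := by
  simp only [prod_const, prod_pow_eq_pow_sum, Fin.card_Ioi]
  -- Since `Ioi a` has `L - 1 - a` elements, each `a` contributes `L`, and the total exponent is the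
  -- even number `2 L²`.
  rw [← pow_add, add_assoc, ← sum_add_distrib,
    sum_congr rfl fun (a : Fin L) _ => show (a : ℕ) + 1 + (L - 1 - a) = L by lia]
  simp [← two_mul]

/-- The symmetric prefactor can be moved into each summand with permuted `u`, where it cancels
against the denominator to leave `(u_b - u_a + γ) / (u_b - u_a)` for each pair. -/
theorem zHat_eq_symSum {L : ℕ} {γ : ℂ} {u : Fin L → ℂ} (hu : Generic γ u) (m : Fin L → ℂ) :
    zHat γ m u = symSum γ (fun a => u a - γ / 2) m := by
  classical
  have hfilter : univ.filter (fun I : Fin L → Fin L => StrictMono I) = {id} := by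
    ext I
    simp only [mem_filter, mem_univ, true_and, mem_singleton]
    refine ⟨fun hI => (hI.range_inj strictMono_id).1 ?_, by rintro rfl; exact strictMono_id⟩
    rw [(Finite.injective_iff_surjective.1 hI.injective).range_eq, Set.range_id]
  rw [zHat, hfilter, sum_singleton, psiHat, psi, symmetrize, symSum, mul_sum]
  refine sum_congr rfl fun σ _ => ?_
  have hsymm : ∏ a, ∏ b ∈ Ioi a, (γ ^ 2 - (u a - u b) ^ 2) =
      ∏ a, ∏ b ∈ Ioi a, (γ ^ 2 - (u (σ a) - u (σ b)) ^ 2) :=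
    (prod_Ioi_comp_perm_of_symm (f := fun a b => γ ^ 2 - (u a - u b) ^ 2)
      (g := fun a b => u a - u b) (fun _ _ => by ring) (fun _ _ => by ring) hu.1 σ).symm
  rw [hsymm]
  simp only [id_eq, prod_mul_distrib (s := (univ : Finset (Fin L)))]
  rw [prod_Iio_eq_prod_Ioi fun a i => u (σ a) - m i - γ / 2]
  have hneg : ∏ a, ∏ i ∈ Ioi a, (-u (σ a) + m i - γ / 2) =
      (∏ a : Fin L, ∏ _b ∈ Ioi a, (-1 : ℂ)) * ∏ a, ∏ i ∈ Ioi a, (u (σ a) - m i + γ / 2) := by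
    simp only [← prod_mul_distrib]
    exact prod_congr rfl fun _ _ => prod_congr rfl fun _ _ => by ring
  rw [hneg]
  set s := ∏ a : Fin L, ∏ _b ∈ Ioi a, (-1 : ℂ) with hs
  calc _ = ((-1 : ℂ) ^ (L * L + ∑ a : Fin L, ((a : ℕ) + 1)) * s) *
      ((∏ a, ∏ b ∈ Ioi a, (γ ^ 2 - (u (σ a) - u (σ b)) ^ 2)) *
        (((∏ a, ∏ b ∈ Ioi a, (u (σ b) - m a - γ / 2)) *
          ∏ a, ∏ i ∈ Ioi a, (u (σ a) - m i + γ / 2)) /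
        ∏ a, ∏ b ∈ Ioi a, ((u (σ b) - u (σ a)) * (u (σ a) - u (σ b) + γ)))) := by ring
    _ = _ := by
      rw [hs, neg_one_pow_mul_prod_Ioi, one_mul, symSummand]
      simp only [← prod_mul_distrib, ← prod_div_distrib]
      refine prod_congr rfl fun a _ => prod_congr rfl fun b hb => ?_
      have hab := (mem_Ioi.1 hb).ne
      have h1 := hu.1 _ _ (σ.injective.ne hab.symm)
      have h2 := hu.2 _ _ (σ.injective.ne hab)
      simp only [Function.comp_apply, sub_sub_sub_cancel_right]
      field_simp
      ring

/-! ### Kostov's determinant -/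

theorem prod_Ioi_sub_comp_perm {L : ℕ} (x : Fin L → ℂ) (σ : Equiv.Perm (Fin L)) :
    ∏ a, ∏ b ∈ Ioi a, (x (σ b) - x (σ a)) = σ.sign * ∏ a, ∏ b ∈ Ioi a, (x b - x a) :=
  σ.prod_Ioi_comp_eq_sign_mul_prod (f := fun a b => x b - x a) fun _ _ => by ring

theorem sign_mul_self {L : ℕ} (σ : Equiv.Perm (Fin L)) :
    ((σ.sign : ℤ) : ℂ) * ((σ.sign : ℤ) : ℂ) = 1 := by
  rcases Int.units_eq_one_or σ.sign with h | h <;> simp [h]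

/-- Kostov's matrix, with denominators cleared. -/
noncomputable def kostovMatrix {L : ℕ} (γ : ℂ) (x y : Fin L → ℂ) : Matrix (Fin L) (Fin L) ℂ :=
  Matrix.of fun a b =>
    (x a + γ / 2) ^ (b : ℕ) * (∏ i, (x a - y i)) -
      (x a - γ / 2) ^ (b : ℕ) * ∏ i, (x a - y i + γ)

/-- Kostov's determinant divided by the Vandermonde product. -/
noncomputable def kostovQuotient {L : ℕ} (γ : ℂ) (x y : Fin L → ℂ) : ℂ :=
  (kostovMatrix γ x y).det / ∏ a, ∏ b ∈ Ioi a, (x b - x a)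

theorem kostovQuotient_comp_perm {L : ℕ} (γ : ℂ) (x y : Fin L → ℂ) (σ : Equiv.Perm (Fin L)) :
    kostovQuotient γ (x ∘ σ) y = kostovQuotient γ x y := by
  have h : kostovMatrix γ (x ∘ σ) y = (kostovMatrix γ x y).submatrix σ id := rfl
  have hσ := sign_mul_self σ
  have hσ0 : ((σ.sign : ℤ) : ℂ) ≠ 0 := left_ne_zero_of_mul_eq_one hσ
  rw [kostovQuotient, h, Matrix.det_permute]
  simp only [Function.comp_apply]
  rw [prod_Ioi_sub_comp_perm, mul_div_mul_left _ _ hσ0, kostovQuotient]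

/-- The coefficient vector of `p(z) = ∏ (z - y_i + γ/2)` lies in the kernel: `p(x - γ/2)` and `p(x +
γ/2)` are exactly the two products in a row, so the terms cancel. This determinant is the
coefficient of `t ^ (L + 1)` in Kostov's. -/
theorem det_kostov_leadingCoeff {L : ℕ} (γ : ℂ) (x : Fin (L + 1) → ℂ) (y : Fin L → ℂ) :
    (Matrix.of fun a b : Fin (L + 1) =>
      (x a - γ / 2) ^ (b : ℕ) * (∏ i, (x a - y i + γ)) -
        (x a + γ / 2) ^ (b : ℕ) * ∏ i, (x a - y i)).det = 0 := by
  set p : Polynomial ℂ := ∏ i, (Polynomial.X - Polynomial.C (y i - γ / 2)) with hp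
  have hmonic : p.Monic := Polynomial.monic_prod_X_sub_C _ _
  have hdeg : p.natDegree = L := by
    rw [hp, Polynomial.natDegree_finsetProd_X_sub_C_eq_card, card_univ, Fintype.card_fin]
  have heval : ∀ z, ∑ b : Fin (L + 1), z ^ (b : ℕ) * p.coeff b = ∏ i, (z - (y i - γ / 2)) := by
    intro z
    rw [Fin.sum_univ_eq_sum_range fun b => z ^ b * p.coeff b]
    have h := Polynomial.eval_eq_sum_range (p := p) z
    rw [hdeg] at h
    simp only [mul_comm (z ^ _), ← h]
    simp only [hp, Polynomial.eval_prod, Polynomial.eval_sub, Polynomial.eval_X, Polynomial.eval_C]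
  refine Matrix.exists_mulVec_eq_zero_iff.1 ⟨fun b => p.coeff b, fun h => ?_, ?_⟩
  · have := congrFun h (Fin.last L)
    simp only [Fin.val_last, Pi.zero_apply] at this
    rw [← hdeg, Polynomial.coeff_natDegree, hmonic.leadingCoeff] at this
    exact one_ne_zero this
  · ext a
    simp only [Matrix.mulVec, dotProduct, Matrix.of_apply, sub_mul, sum_sub_distrib, Pi.zero_apply,
      mul_right_comm _ _ (p.coeff _), ← sum_mul, heval]
    rw [mul_comm, sub_eq_zero]
    congr 1 <;> exact prod_congr rfl fun i _ => by ring

theorem isPolyLE_kostovQuotient_cons {L : ℕ} (γ : ℂ) (x : Fin (L + 1) → ℂ) (y : Fin L → ℂ) :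
    IsPolyLE L fun t => kostovQuotient γ x (Fin.cons t y : Fin (L + 1) → ℂ) := by
  simp only [kostovQuotient, div_eq_mul_inv]
  refine IsPolyLE.mul_const ?_ _
  set A : Matrix (Fin (L + 1)) (Fin (L + 1)) ℂ := Matrix.of fun a b =>
    (x a - γ / 2) ^ (b : ℕ) * (∏ i, (x a - y i + γ)) -
      (x a + γ / 2) ^ (b : ℕ) * ∏ i, (x a - y i) with hA
  set B : Matrix (Fin (L + 1)) (Fin (L + 1)) ℂ := Matrix.of fun a b =>
    (x a + γ / 2) ^ (b : ℕ) * (x a * ∏ i, (x a - y i)) -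
      (x a - γ / 2) ^ (b : ℕ) * ((x a + γ) * ∏ i, (x a - y i + γ)) with hB
  -- Each entry is affine in `t`, so the matrix is `t A + B`; a priori the degree is `L + 1`, and
  -- the top coefficient `det A` vanishes.
  set p : Polynomial ℂ :=
    ((Polynomial.X : Polynomial ℂ) • A.map Polynomial.C + B.map Polynomial.C).det with hp
  refine ⟨p, ?_, fun t => ?_⟩
  · have h1 : p.natDegree ≤ L + 1 := by
      simpa using Polynomial.natDegree_det_X_add_C_le A B
    have h2 : p.coeff (L + 1) = 0 := by
      have := Polynomial.coeff_det_X_add_C_card A B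
      rw [Fintype.card_fin] at this
      rw [hp, this, hA, det_kostov_leadingCoeff]
    exact Polynomial.natDegree_le_iff_coeff_eq_zero.2 fun N hN => by
      rcases (Nat.succ_le_of_lt hN).eq_or_lt with h | h
      · rw [← h]; exact h2
      · exact Polynomial.coeff_eq_zero_of_natDegree_lt (h1.trans_lt h)
  · rw [hp, ← Polynomial.coe_evalRingHom, RingHom.map_det]
    refine congrArg Matrix.det ?_
    ext a b
    simp only [RingHom.mapMatrix_apply, Matrix.map_apply, Matrix.add_apply, Matrix.smul_apply,
      smul_eq_mul, Polynomial.coe_evalRingHom, Polynomial.eval_add, Polynomial.eval_mul,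
      Polynomial.eval_X, Polynomial.eval_C, kostovMatrix, A, B, Matrix.of_apply,
      Fin.prod_univ_succ, Fin.cons_zero, Fin.cons_succ]
    ring

theorem kostovQuotient_cons_self {L : ℕ} {γ : ℂ} (x : Fin (L + 1) → ℂ) (y : Fin L → ℂ)
    (hx : Generic γ x) :
    kostovQuotient γ x (Fin.cons (x 0) y : Fin (L + 1) → ℂ) =
      -γ * ((∏ i, (x 0 - y i + γ)) * ∏ i : Fin L, (x i.succ - x 0 + γ)) *
        kostovQuotient γ (x ∘ Fin.succ) y := by
  have hne : ∏ i : Fin L, (x i.succ - x 0) ≠ 0 :=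
    prod_ne_zero_iff.2 fun i _ => hx.1 _ _ (Fin.succ_ne_zero i)
  set B : Matrix (Fin (L + 1)) (Fin (L + 1)) ℂ := Matrix.of fun a =>
    Fin.cons (kostovMatrix γ x (Fin.cons (x 0) y) a 0) fun b : Fin L =>
      (x a - x 0 + γ) * (x a - x 0) * ((x a + γ / 2) ^ (b : ℕ) * (∏ i, (x a - y i)) -
        (x a - γ / 2) ^ (b : ℕ) * ∏ i, (x a - y i + γ)) with hB
  have hdet : (kostovMatrix γ x (Fin.cons (x 0) y)).det = B.det := by
    -- Subtracting `x 0 - γ/2` times the previous column gives both terms of an entry the common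
    -- factor `(x a - x 0 + γ) (x a - x 0)`, which kills row `0` outside the first column.
    refine Matrix.det_eq_of_forall_col_eq_smul_add_pred (fun _ => x 0 - γ / 2)
      (fun a => by simp [hB]) fun a b => ?_
    simp [hB, kostovMatrix, Fin.prod_univ_succ, pow_succ]
    ring
  rw [kostovQuotient, hdet, Matrix.det_succ_row_zero, sum_eq_single 0]
  · have hsub : B.submatrix Fin.succ (Fin.succAbove 0) =
        Matrix.of fun a b => ((x a.succ - x 0 + γ) * (x a.succ - x 0)) *
          kostovMatrix γ (x ∘ Fin.succ) y a b := by
      ext a b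
      simp [hB, kostovMatrix]
    rw [hsub, Matrix.det_mul_column]
    have hB0 : B 0 0 = -(γ * ∏ i, (x 0 - y i + γ)) := by
      simp [hB, kostovMatrix, Fin.prod_univ_succ]
    rw [hB0]
    simp only [kostovQuotient, Fin.prod_univ_succ (n := L), Fin.prod_Ioi_zero, Fin.prod_Ioi_succ,
      prod_mul_distrib, Function.comp_apply]
    simp only [Fin.val_zero, pow_zero, one_mul]
    field_simp
  · intro b _ hb
    obtain ⟨j, rfl⟩ := Fin.exists_succ_eq_of_ne_zero hb
    simp [hB]
  · simp

theorem kostovQuotient_eq_symSum {L : ℕ} {γ : ℂ} (x y : Fin L → ℂ) (hx : Generic γ x) :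
    kostovQuotient γ x y = (-γ) ^ L * symSum γ x y :=
  eq_pow_mul_symSum (fun {_} => kostovQuotient γ) (fun x y => by simp [kostovQuotient])
    (fun x y _ σ => kostovQuotient_comp_perm γ x y σ) (isPolyLE_kostovQuotient_cons γ)
    kostovQuotient_cons_self x y hx

theorem kostov_eq_kostovQuotient {L : ℕ} {γ : ℂ} (m u : Fin L → ℂ)
    (h : ∀ a b, u a - m b + γ / 2 ≠ 0) :
    kostov γ m u = kostovQuotient γ (fun a => u a - γ / 2) m := by
  have hM : kostovMatrix γ (fun a => u a - γ / 2) m = Matrix.of fun a b =>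
      (∏ i, (u a - m i + γ / 2)) * (Matrix.of fun a b : Fin L =>
        u a ^ (b : ℕ) * (∏ i, (u a - m i - γ / 2) / (u a - m i + γ / 2)) -
          (u a - γ) ^ (b : ℕ)) a b := by
    ext a b
    have h0 : ∏ i, (u a - m i + γ / 2) ≠ 0 := prod_ne_zero_iff.2 fun i _ => h a i
    have e1 : ∀ i, u a - γ / 2 - m i = u a - m i - γ / 2 := fun i => by ring
    have e2 : ∀ i, u a - m i - γ / 2 + γ = u a - m i + γ / 2 := fun i => by ring
    simp only [kostovMatrix, Matrix.of_apply, prod_div_distrib, e1, e2]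
    rw [sub_sub, add_halves, sub_add_cancel, mul_sub, mul_left_comm, mul_div_cancel₀ _ h0,
      mul_comm (∏ i, (u a - m i + γ / 2))]
  rw [kostov, kostovQuotient, hM, Matrix.det_mul_column]
  simp only [sub_sub_sub_cancel_right]
  ring

/-! ### The six-vertex model: commuting rows -/

/-- The entries of a product of matrices are sums over paths. -/
theorem prod_ofFn_apply {ι : Type*} [Fintype ι] [DecidableEq ι] {n : ℕ}
    (M : Fin n → Matrix ι ι ℂ) (a b : ι) :
    (List.ofFn M).prod a b =
      ∑ v : Fin (n + 1) → ι with v 0 = a ∧ v (Fin.last n) = b,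
        ∏ i : Fin n, M i (v i.castSucc) (v i.succ) := by
  induction n generalizing a with
  | zero =>
    rw [sum_filter, ← (Equiv.funUnique (Fin 1) ι).symm.sum_comp]
    simp [Matrix.one_apply, ite_and]
  | succ n ih =>
    rw [List.ofFn_succ, List.prod_cons, Matrix.mul_apply, sum_filter,
      ← (Fin.consEquiv fun _ : Fin (n + 2) => ι).sum_comp, Fintype.sum_prod_type]
    symm
    rw [sum_eq_single a]
    · simp only [ih, sum_filter, mul_sum, Fin.consEquiv_apply]
      rw [sum_comm]
      refine sum_congr rfl fun v _ => ?_
      rw [sum_eq_single (v 0)]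
      · simp [Fin.prod_univ_succ, ← Fin.succ_last, Fin.cons_succ]
      · intro j _ hj
        rw [if_neg (fun h => hj h.1.symm), mul_zero]
      · simp
    · intro p _ hp
      simp [Fin.consEquiv_apply, hp]
    · simp

/-- The matrix of a vertical line crossing two rows, between the states left and right of it. -/
noncomputable def doubleRow (γ x x' y : ℂ) (s t : Colour) :
    Matrix (Colour × Colour) (Colour × Colour) ℂ :=
  Matrix.of fun p q =>
    ∑ r, vertexWeight γ x y p.1 s q.1 r * vertexWeight γ x' y p.2 r q.2 t

/-- The rational `R`-matrix. -/
noncomputable def rMatrix (γ d : ℂ) : Matrix (Colour × Colour) (Colour × Colour) ℂ :=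
  Matrix.of fun p q => (if p = q then γ else 0) + if p = q.swap then d else 0

/-- The Yang-Baxter (RLL) relation for one column, checked on all colours of the outer bonds. -/
theorem semiconjBy_rMatrix (γ x x' y : ℂ) (s t : Colour) :
    SemiconjBy (rMatrix γ (x - x')) (doubleRow γ x x' y s t) (doubleRow γ x' x y s t) := by
  ext ⟨p, p'⟩ ⟨q, q'⟩
  simp only [Matrix.mul_apply, Fintype.sum_prod_type, Fin.sum_univ_two, rMatrix, doubleRow,
    Matrix.of_apply, vertexWeight, Prod.swap_prod_mk, Prod.mk.injEq]
  fin_cases s <;> fin_cases t <;> fin_cases p <;> fin_cases p' <;> fin_cases q <;>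
    fin_cases q' <;> simp <;> ring

theorem semiconjBy_prod_ofFn {M : Type*} [Monoid M] {n : ℕ} {r : M} {f g : Fin n → M}
    (h : ∀ i, SemiconjBy r (f i) (g i)) :
    SemiconjBy r (List.ofFn f).prod (List.ofFn g).prod := by
  induction n with
  | zero => simp
  | succ n ih =>
    simp only [List.ofFn_succ, List.prod_cons]
    exact (h 0).mul_right (ih fun i => h i.succ)

/-- The matrix of a single row, between the states below and above it, with colour `1` on the left
and colour `2` on the right. -/
noncomputable def rowMatrix {L : ℕ} (γ : ℂ) (y : Fin L → ℂ) (x : ℂ) :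
    Matrix (Fin L → Colour) (Fin L → Colour) ℂ :=
  Matrix.of fun s t =>
    ∑ h : Fin (L + 1) → Colour with h 0 = colour1 ∧ h (Fin.last L) = colour2,
      ∏ j : Fin L, vertexWeight γ x (y j) (h j.castSucc) (s j) (h j.succ) (t j)

/-- Regroups a two-row sum column by column, so that an `R`-matrix can be pulled through it. -/
theorem rowMatrix_mul_apply {L : ℕ} (γ : ℂ) (y : Fin L → ℂ) (x x' : ℂ) (s t : Fin L → Colour) :
    (rowMatrix γ y x * rowMatrix γ y x') s t =
      (List.ofFn fun j => doubleRow γ x x' (y j) (s j) (t j)).prod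
        (colour1, colour1) (colour2, colour2) := by
  rw [prod_ofFn_apply, Matrix.mul_apply, sum_filter,
    ← (Equiv.arrowProdEquivProdArrow (Fin (L + 1)) (fun _ => Colour)
      (fun _ => Colour)).symm.sum_comp, Fintype.sum_prod_type]
  simp only [rowMatrix, Matrix.of_apply, sum_mul_sum, doubleRow, sum_filter]
  rw [sum_comm]
  refine sum_congr rfl fun h _ => ?_
  rw [sum_comm]
  refine sum_congr rfl fun h' _ => ?_
  simp only [Equiv.arrowProdEquivProdArrow, Equiv.coe_fn_symm_mk, prod_univ_sum,
    Fintype.piFinset_univ, prod_mul_distrib, Prod.mk.injEq]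
  by_cases h1 : h 0 = colour1 ∧ h (Fin.last L) = colour2 <;>
    by_cases h2 : h' 0 = colour1 ∧ h' (Fin.last L) = colour2
  · simp [h1, h2]
  · rw [if_neg (by tauto)]; simp [h2]
  · rw [if_neg (by tauto)]; simp [h1]
  · rw [if_neg (by tauto)]; simp [h1]

theorem rowMatrix_commute {L : ℕ} {γ : ℂ} (y : Fin L → ℂ) {x x' : ℂ} (h : x - x' + γ ≠ 0) :
    Commute (rowMatrix γ y x) (rowMatrix γ y x') := by
  ext s t
  rw [rowMatrix_mul_apply, rowMatrix_mul_apply]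
  have hR := congrFun₂ (semiconjBy_prod_ofFn fun j =>
    semiconjBy_rMatrix γ x x' (y j) (s j) (t j)).eq (colour1, colour1) (colour2, colour2)
  simp only [Matrix.mul_apply, Fintype.sum_prod_type, Fin.sum_univ_two, rMatrix,
    Matrix.of_apply, colour1, colour2, Prod.swap_prod_mk, Prod.mk.injEq] at hR ⊢
  -- The states `(1, 1)` and `(2, 2)` at the two ends are eigenvectors of `R` with the same
  -- eigenvalue `γ + (x - x')`, which is nonzero and cancels.
  simp at hR
  rw [mul_comm] at hR
  refine mul_right_cancel₀ (b := γ + (x - x')) ?_ hR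
  rwa [add_comm]

theorem dwpf_eq_prod_rowMatrix {L : ℕ} (γ : ℂ) (x y : Fin L → ℂ) :
    dwpf γ x y =
      (List.ofFn fun i => rowMatrix γ y (x i)).prod (fun _ => colour2) (fun _ => colour1) := by
  classical
  rw [prod_ofFn_apply, dwpf, sum_filter, Fintype.sum_prod_type_right, sum_filter]
  refine sum_congr rfl fun v _ => ?_
  simp only [rowMatrix, Matrix.of_apply, prod_univ_sum, ← sum_filter]
  by_cases hv : v 0 = (fun _ => colour2) ∧ v (Fin.last L) = fun _ => colour1
  · rw [if_pos hv]
    refine sum_congr ?_ fun _ _ => rfl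
    ext h
    simp [IsDomainWall, hv, forall_and]
  · rw [if_neg hv]
    refine sum_eq_zero fun h hh => ?_
    exact absurd (mem_filter.1 hh).2 fun hd => hv ⟨funext hd.2.2.1, funext hd.2.2.2⟩

theorem dwpf_comp_perm {L : ℕ} {γ : ℂ} (x y : Fin L → ℂ) (hx : Generic γ x)
    (σ : Equiv.Perm (Fin L)) : dwpf γ (x ∘ σ) y = dwpf γ x y := by
  rw [dwpf_eq_prod_rowMatrix, dwpf_eq_prod_rowMatrix]
  have h : (List.ofFn fun i => rowMatrix γ y ((x ∘ σ) i)).prod =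
      (List.ofFn fun i => rowMatrix γ y (x i)).prod := by
    refine List.Perm.prod_eq' (σ.ofFn_comp_perm fun i => rowMatrix γ y (x i)) ?_
    rw [List.pairwise_ofFn]
    exact fun i j hij => rowMatrix_commute y (hx.2 _ _ (σ.injective.ne hij.ne))
  rw [h]

/-! ### The six-vertex model: freezing and degree -/

/-- The extension of a configuration by a frozen row and a frozen column. -/
def extendConfiguration {L : ℕ} (c : Configuration L) : Configuration (L + 1) :=
  (Fin.cons (Fin.cons colour1 fun _ => colour2) fun i => Fin.cons colour1 (c.1 i),
    Fin.cons (fun _ => colour2) fun i => Fin.cons colour1 (c.2 i))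

theorem extendConfiguration_injective (L : ℕ) :
    Function.Injective (extendConfiguration (L := L)) := by
  intro c d h
  simp only [extendConfiguration, Prod.mk.injEq, Fin.cons_inj, true_and] at h
  refine Prod.ext (funext fun i => ?_) (funext fun i => ?_)
  · simpa [Fin.cons_inj] using congrFun h.1 i
  · simpa [Fin.cons_inj] using congrFun h.2 i

theorem IsDomainWall.extendConfiguration {L : ℕ} {c : Configuration L} (hc : IsDomainWall c) :
    IsDomainWall (extendConfiguration c) := by
  obtain ⟨h1, h2, h3, h4⟩ := hc
  refine ⟨Fin.cases ?_ ?_, Fin.cases ?_ ?_, ?_, Fin.cases ?_ ?_⟩ <;>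
    simp [OrbifoldDefect.extendConfiguration, ← Fin.succ_last, h2, h4]

theorem vertexWeight_self_ne_zero {γ x : ℂ} {r t : Colour}
    (h : vertexWeight γ x x colour1 colour2 r t ≠ 0) : r = colour2 ∧ t = colour1 := by
  revert h
  fin_cases r <;> fin_cases t <;> simp [vertexWeight, colour1, colour2]

theorem vertexWeight_colour1_ne_zero {γ x y : ℂ} {r t : Colour}
    (h : vertexWeight γ x y colour1 colour1 r t ≠ 0) : r = colour1 ∧ t = colour1 := by
  revert h
  fin_cases r <;> fin_cases t <;> simp [vertexWeight, colour1]

theorem vertexWeight_colour2_ne_zero {γ x y : ℂ} {r t : Colour}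
    (h : vertexWeight γ x y colour2 colour2 r t ≠ 0) : r = colour2 ∧ t = colour2 := by
  revert h
  fin_cases r <;> fin_cases t <;> simp [vertexWeight, colour2]

/-- At `x 0 = y 0` the straight weight of the bottom left vertex vanishes, so its lines turn; colour
conservation then propagates along the first column and the bottom row and freezes both. -/
theorem mem_range_extendConfiguration {L : ℕ} {γ : ℂ} {x y : Fin (L + 1) → ℂ} (hxy : x 0 = y 0)
    {c : Configuration (L + 1)} (hc : IsDomainWall c)
    (hw : ∀ i j, vertexWeight γ (x i) (y j)
      (c.1 i j.castSucc) (c.2 i.castSucc j) (c.1 i j.succ) (c.2 i.succ j) ≠ 0) :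
    ∃ d, IsDomainWall d ∧ extendConfiguration d = c := by
  obtain ⟨h1, h2, h3, h4⟩ := hc
  have h00 : c.1 0 (Fin.succ 0) = colour2 ∧ c.2 (Fin.succ 0) 0 = colour1 := by
    have h := hw 0 0
    rw [Fin.castSucc_zero, h1, h3, hxy] at h
    exact vertexWeight_self_ne_zero h
  have hcol : ∀ i : Fin (L + 1), c.2 i.succ 0 = colour1 := by
    intro i
    induction i using Fin.induction with
    | zero => exact h00.2
    | succ i ih =>
      have h := hw i.succ 0
      rw [Fin.castSucc_zero, ← Fin.succ_castSucc, h1, ih] at h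
      exact (vertexWeight_colour1_ne_zero h).2
  have hcol' : ∀ i : Fin L, c.1 i.succ (Fin.succ 0) = colour1 := by
    intro i
    have h := hw i.succ 0
    rw [Fin.castSucc_zero, ← Fin.succ_castSucc, h1, hcol] at h
    exact (vertexWeight_colour1_ne_zero h).1
  have hrow : ∀ j : Fin (L + 1), c.1 0 j.succ = colour2 := by
    intro j
    induction j using Fin.induction with
    | zero => exact h00.1
    | succ j ih =>
      have h := hw 0 j.succ
      rw [Fin.castSucc_zero, ← Fin.succ_castSucc, h3, ih] at h
      exact (vertexWeight_colour2_ne_zero h).1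
  have hrow' : ∀ j : Fin L, c.2 (Fin.succ 0) j.succ = colour2 := by
    intro j
    have h := hw 0 j.succ
    rw [Fin.castSucc_zero, ← Fin.succ_castSucc, h3, hrow] at h
    exact (vertexWeight_colour2_ne_zero h).2
  refine ⟨(fun i j => c.1 i.succ j.succ, fun i j => c.2 i.succ j.succ),
    ⟨hcol', fun i => h2 _, hrow', fun j => h4 _⟩, Prod.ext (funext fun i => ?_) (funext fun i => ?_)⟩
  · refine Fin.cases (funext fun j => ?_) (fun i => funext fun j => ?_) i <;>
      refine Fin.cases ?_ (fun j => ?_) j <;> simp [extendConfiguration, h1, hrow]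
  · refine Fin.cases (funext fun j => ?_) (fun i => funext fun j => ?_) i
    · simp [extendConfiguration, h3]
    · refine Fin.cases ?_ (fun j => ?_) j <;> simp [extendConfiguration, hcol]

theorem dwpf_cons_self {L : ℕ} (γ : ℂ) (x : Fin (L + 1) → ℂ) (y : Fin L → ℂ) :
    dwpf γ x (Fin.cons (x 0) y : Fin (L + 1) → ℂ) =
      γ * ((∏ i, (x 0 - y i + γ)) * ∏ i : Fin L, (x i.succ - x 0 + γ)) *
        dwpf γ (x ∘ Fin.succ) y := by
  classical
  symm
  rw [dwpf, dwpf, mul_sum]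
  refine sum_of_injOn extendConfiguration (extendConfiguration_injective L).injOn ?_ ?_ ?_
  · intro c hc
    simp only [coe_filter, mem_univ, true_and, Set.mem_ofPred_eq] at hc ⊢
    exact hc.extendConfiguration
  · intro c hc hnot
    by_contra hne
    simp only [prod_eq_zero_iff, mem_univ, true_and, not_exists] at hne
    obtain ⟨d, hd, rfl⟩ := mem_range_extendConfiguration (by simp) (mem_filter.1 hc).2 hne
    exact hnot ⟨d, by simpa using hd, rfl⟩
  · intro c hc
    obtain ⟨h1, -, h3, -⟩ := (mem_filter.1 hc).2
    simp [Fin.prod_univ_succ (n := L), extendConfiguration, h1, h3, prod_mul_distrib,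
      -Fin.succ_zero_eq_one, -Fin.castSucc_succ, ← Fin.succ_castSucc]
    simp [vertexWeight, colour1, colour2]
    ring

theorem isPolyLE_dwpf_cons {L : ℕ} (γ : ℂ) (x : Fin (L + 1) → ℂ) (y : Fin L → ℂ) :
    IsPolyLE L fun t => dwpf γ x (Fin.cons t y : Fin (L + 1) → ℂ) := by
  classical
  refine .sum _ fun c hc => ?_
  obtain ⟨-, -, h3, h4⟩ := (mem_filter.1 hc).2
  -- The first column runs from colour `2` to colour `1`, so some vertex changes its vertical
  -- colour. Its weight is free of `t`, which lowers the degree from `L + 1` to `L`.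
  obtain ⟨k, hk⟩ : ∃ k : Fin (L + 1), c.2 k.castSucc 0 ≠ c.2 k.succ 0 := by
    by_contra! h
    have h5 : ∀ i, c.2 i 0 = colour2 := fun i => by
      induction i using Fin.induction with
      | zero => exact h3 0
      | succ i ih => rw [← h, ih]
    exact absurd ((h5 _).symm.trans (h4 0)) (by decide)
  have hterm : ∀ t, (∏ i, ∏ j, vertexWeight γ (x i) ((Fin.cons t y : Fin (L + 1) → ℂ) j)
      (c.1 i j.castSucc) (c.2 i.castSucc j) (c.1 i j.succ) (c.2 i.succ j)) =
      (∏ i, vertexWeight γ (x i) t (c.1 i 0) (c.2 i.castSucc 0) (c.1 i (Fin.succ 0))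
        (c.2 i.succ 0)) *
      ∏ i, ∏ j : Fin L, vertexWeight γ (x i) (y j) (c.1 i j.succ.castSucc)
        (c.2 i.castSucc j.succ) (c.1 i j.succ.succ) (c.2 i.succ j.succ) := fun t => by
    rw [← prod_mul_distrib]
    refine prod_congr rfl fun i _ => ?_
    rw [Fin.prod_univ_succ]
    simp only [Fin.cons_zero, Fin.cons_succ, Fin.castSucc_zero]
  simp only [hterm]
  refine .mul_const ?_ _
  refine (IsPolyLE.prod univ (d := fun i => if i = k then 0 else 1) fun i _ => ?_).mono ?_
  · unfold vertexWeight
    by_cases hik : i = k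
    · subst hik
      simp only [hk, and_false, if_false, if_true]
      exact .const _ _
    · simp only [hik, if_false]
      split_ifs
      · simpa only [sub_add_eq_add_sub] using IsPolyLE.const_sub (x i + γ)
      · exact .const_sub _
      · exact .const _ _
      · exact .const _ _
  · simp [sum_ite, filter_ne']

theorem dwpf_eq_symSum {L : ℕ} {γ : ℂ} (x y : Fin L → ℂ) (hx : Generic γ x) :
    dwpf γ x y = γ ^ L * symSum γ x y :=
  eq_pow_mul_symSum (fun {_} => dwpf γ) (fun x y => by simp [dwpf, IsDomainWall])
    dwpf_comp_perm (isPolyLE_dwpf_cons γ) (fun x y _ => dwpf_cons_self γ x y) x y hx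

/-! ### Izergin's determinant -/

/-- The product of the two linear factors in Izergin's matrix. -/
def izerginFactor (γ s t : ℂ) : ℂ := (s - t) * (s - t + γ)

/-- Izergin's matrix with the denominators of the first column cleared. -/
noncomputable def izerginMatrix {L : ℕ} (γ : ℂ) (x : Fin (L + 1) → ℂ) (y : Fin L → ℂ) (t : ℂ) :
    Matrix (Fin (L + 1)) (Fin (L + 1)) ℂ :=
  Matrix.of fun a => Fin.cons (∏ b ∈ univ.erase a, izerginFactor γ (x b) t)
    fun i => 1 / izerginFactor γ (x a) (y i)

theorem isPolyLE_det_izerginMatrix {L : ℕ} (γ : ℂ) (x : Fin (L + 1) → ℂ) (y : Fin L → ℂ) :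
    IsPolyLE (L + L) fun t => (izerginMatrix γ x y t).det := by
  simp only [Matrix.det_succ_column_zero]
  refine .sum _ fun a _ => ?_
  have hminor : ∀ t, ((izerginMatrix γ x y t).submatrix a.succAbove Fin.succ) =
      Matrix.of fun c i => 1 / izerginFactor γ (x (a.succAbove c)) (y i) := fun t => by
    ext c i
    simp [izerginMatrix]
  simp only [hminor]
  refine .mul_const (.const_mul _ ?_) _
  simp only [izerginMatrix, Matrix.of_apply, Fin.cons_zero]
  refine (IsPolyLE.prod _ (d := fun _ => 1 + 1) fun b _ => ?_).mono ?_
  · refine (IsPolyLE.const_sub _).mul ?_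
    simpa only [sub_add_eq_add_sub] using IsPolyLE.const_sub (x b + γ)
  · simp [card_erase_of_mem, mul_two]

theorem det_izerginMatrix_comp_perm {L : ℕ} (γ : ℂ) (x : Fin (L + 1) → ℂ) (y : Fin L → ℂ) (t : ℂ)
    (σ : Equiv.Perm (Fin (L + 1))) :
    (izerginMatrix γ (x ∘ σ) y t).det = σ.sign * (izerginMatrix γ x y t).det := by
  rw [← Matrix.det_permute]
  congr 1
  ext a b
  refine Fin.cases ?_ (fun i => ?_) b
  · simp only [izerginMatrix, Matrix.of_apply, Fin.cons_zero, Matrix.submatrix_apply, id]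
    exact prod_equiv σ (by simp) (by simp)
  · simp [izerginMatrix]

/-- At `t = y i` the first column is a multiple of column `i.succ`. -/
theorem det_izerginMatrix_right {L : ℕ} {γ : ℂ} {x : Fin (L + 1) → ℂ} {y : Fin L → ℂ}
    (h : ∀ a i, izerginFactor γ (x a) (y i) ≠ 0) (i : Fin L) :
    (izerginMatrix γ x y (y i)).det = 0 := by
  refine Matrix.exists_mulVec_eq_zero_iff.1
    ⟨Pi.single 0 1 - Pi.single i.succ (∏ b, izerginFactor γ (x b) (y i)), fun h0 => ?_, ?_⟩
  · simpa [(Fin.succ_ne_zero i).symm] using congrFun h0 0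
  · ext a
    have ha := h a i
    simp only [Matrix.mulVec_sub, Matrix.mulVec_single, izerginMatrix]
    simp [← mul_prod_erase univ (fun b => izerginFactor γ (x b) (y i)) (mem_univ a)]
    field_simp
    ring

theorem det_izerginMatrix_left {L : ℕ} (γ : ℂ) (x : Fin (L + 1) → ℂ) (y : Fin L → ℂ) :
    (izerginMatrix γ x y (x 0)).det =
      (∏ i : Fin L, izerginFactor γ (x i.succ) (x 0)) *
        (Matrix.of fun a i => 1 / izerginFactor γ ((x ∘ Fin.succ) a) (y i)).det := by
  rw [Matrix.det_succ_column_zero, sum_eq_single 0]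
  · have hminor : (izerginMatrix γ x y (x 0)).submatrix (Fin.succAbove 0) Fin.succ =
        Matrix.of fun a i => 1 / izerginFactor γ ((x ∘ Fin.succ) a) (y i) := by
      ext c i
      simp [izerginMatrix]
    rw [hminor]
    simp [izerginMatrix, Fin.univ_succ]
  · intro a _ ha
    have : izerginMatrix γ x y (x 0) a 0 = 0 :=
      prod_eq_zero (mem_erase.2 ⟨ha.symm, mem_univ _⟩) (by simp [izerginFactor])
    rw [this]
    ring
  · simp

theorem det_izerginMatrix_cons {L : ℕ} {γ t : ℂ} {x : Fin (L + 1) → ℂ} {y : Fin L → ℂ}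
    (h : ∀ a, izerginFactor γ (x a) t ≠ 0) :
    (izerginMatrix γ x y t).det = (∏ a, izerginFactor γ (x a) t) *
      (Matrix.of fun a b => 1 / izerginFactor γ (x a) ((Fin.cons t y : Fin (L + 1) → ℂ) b)).det := by
  set v : Fin (L + 1) → ℂ := Fin.cons (∏ a, izerginFactor γ (x a) t) fun _ => 1 with hv
  have hprod : ∏ b, v b = ∏ a, izerginFactor γ (x a) t := by simp [hv, Fin.prod_univ_succ (n := L)]
  rw [← hprod, ← Matrix.det_mul_row]
  congr 1
  ext a b
  refine Fin.cases ?_ (fun i => ?_) b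
  · have ha := h a
    simp only [izerginMatrix, Matrix.of_apply, Fin.cons_zero, hv,
      ← mul_prod_erase univ (fun a => izerginFactor γ (x a) t) (mem_univ a)]
    field_simp
  · simp [izerginMatrix, hv]

theorem izergin_det_eq_symSum {L : ℕ} {γ : ℂ} (x y : Fin L → ℂ) (hx : Generic γ x)
    (hy : Function.Injective y) (h : ∀ a b, izerginFactor γ (x a) (y b) ≠ 0) :
    (∏ a, ∏ b, izerginFactor γ (x a) (y b)) *
        (Matrix.of fun a b => 1 / izerginFactor γ (x a) (y b)).det =
      symSum γ x y * ((∏ a, ∏ b ∈ Ioi a, (x b - x a)) * ∏ a, ∏ b ∈ Ioi a, (y a - y b)) := by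
  induction L with
  | zero => simp [symSum, symSummand]
  | succ L ih =>
    obtain ⟨t, y, rfl⟩ : ∃ t z, y = Fin.cons t z := ⟨y 0, Fin.tail y, (Fin.cons_self_tail y).symm⟩
    have hy' : Function.Injective y := fun i j hij => by
      have := @hy i.succ j.succ (by simpa using hij)
      simpa using this
    have h' : ∀ a i, izerginFactor γ (x a) (y i) ≠ 0 := fun a i => by simpa using h a i.succ
    have ht : ∀ a, izerginFactor γ (x a) t ≠ 0 := fun a => by simpa using h a 0
    have key : (fun s => (izerginMatrix γ x y s).det * ∏ a, ∏ i, izerginFactor γ (x a) (y i)) =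
        fun s => symSum γ x (Fin.cons s y) * (∏ i, (s - y i)) *
          ((∏ a, ∏ b ∈ Ioi a, (x b - x a)) * ∏ a, ∏ b ∈ Ioi a, (y a - y b)) := by
      have hdeg : IsPolyLE L fun s => ∏ i, (s - y i) :=
        (IsPolyLE.prod univ (d := fun _ => 1) fun i _ => by
          simpa [sub_eq_add_neg, add_comm] using IsPolyLE.linear (-y i) 1).mono (by simp)
      refine ((isPolyLE_det_izerginMatrix γ x y).mul_const _).eq_of_eqOn
        (((isPolyLE_symSum_cons γ x y).mul hdeg).mul_const _)
        -- These are `2L + 1` distinct nodes: a common value of `x` and `y` would make an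
        -- `izerginFactor` vanish.
        (univ.image x ∪ univ.image y) ?_ fun s hs => ?_
      · rw [card_union_of_disjoint, card_image_of_injective _ hx.injective,
          card_image_of_injective _ hy']
        · simp
        · rw [disjoint_left]
          intro s hs hs'
          obtain ⟨a, -, rfl⟩ := mem_image.1 hs
          obtain ⟨i, -, hi⟩ := mem_image.1 hs'
          exact h' a i (by simp [izerginFactor, hi])
      · rcases mem_union.1 hs with hs | hs
        · obtain ⟨p, -, rfl⟩ := mem_image.1 hs
          set σ := Equiv.swap 0 p with hσ
          have hx' := hx.comp σ.injective
          have hxp : (x ∘ σ) 0 = x p := by simp [hσ]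
          have e1 := det_izerginMatrix_left γ (x ∘ σ) y
          have e2 := symSum_cons_self hx' y
          have e3 := ih ((x ∘ σ) ∘ Fin.succ) y (hx'.comp (Fin.succ_injective L)) hy'
            fun a i => h' _ _
          have e4 := prod_Ioi_sub_comp_perm x σ
          have e5 : ∏ a, ∏ i, izerginFactor γ (x a) (y i) =
              ∏ a, ∏ i, izerginFactor γ ((x ∘ σ) a) (y i) :=
            (Equiv.prod_comp σ fun a => ∏ i, izerginFactor γ (x a) (y i)).symm
          have hs := sign_mul_self σ
          rw [hxp, det_izerginMatrix_comp_perm] at e1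
          rw [hxp, symSum_comp_perm] at e2
          -- Moving `x p` to position `0` changes the determinant and the Vandermonde product by the
          -- same sign.
          refine mul_left_cancel₀ (left_ne_zero_of_mul_eq_one hs) ?_
          calc _ = (σ.sign * (izerginMatrix γ x y (x p)).det) *
                ∏ a, ∏ i, izerginFactor γ (x a) (y i) := by ring
            _ = (∏ i : Fin L, izerginFactor γ ((x ∘ σ) i.succ) (x p)) *
                (∏ i, izerginFactor γ (x p) (y i)) *
                  (symSum γ ((x ∘ σ) ∘ Fin.succ) y *
                    ((∏ a, ∏ b ∈ Ioi a, (((x ∘ σ) ∘ Fin.succ) b - ((x ∘ σ) ∘ Fin.succ) a)) *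
                      ∏ a, ∏ b ∈ Ioi a, (y a - y b))) := by
              rw [e1, e5, Fin.prod_univ_succ, hxp, ← e3]
              simp only [Function.comp_apply]
              ring
            _ = symSum γ x (Fin.cons (x p) y) * (∏ i, (x p - y i)) *
                ((σ.sign * ∏ a, ∏ b ∈ Ioi a, (x b - x a)) * ∏ a, ∏ b ∈ Ioi a, (y a - y b)) := by
              rw [e2, ← e4, Fin.prod_univ_succ (n := L), Fin.prod_Ioi_zero]
              simp only [Fin.prod_Ioi_succ, izerginFactor, prod_mul_distrib]
              rw [show x (σ 0) = x p from hxp]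
              simp only [Function.comp_apply]
              ring
            _ = _ := by ring
        · obtain ⟨i, -, rfl⟩ := mem_image.1 hs
          rw [det_izerginMatrix_right h', prod_eq_zero (mem_univ i) (sub_self (y i))]
          ring
    have hkey := congrFun key t
    simp only [det_izerginMatrix_cons ht] at hkey
    simp only [Fin.prod_univ_succ (n := L), Fin.cons_zero, Fin.cons_succ, Fin.prod_Ioi_zero,
      Fin.prod_Ioi_succ, prod_mul_distrib] at hkey ⊢
    linear_combination hkey

theorem izergin_eq_symSum {L : ℕ} {γ : ℂ} {u m : Fin L → ℂ} (hu : Generic γ u)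
    (hm : ∀ a b, a ≠ b → m a - m b ≠ 0) (h1 : ∀ a b, u a - m b - γ / 2 ≠ 0)
    (h2 : ∀ a b, u a - m b + γ / 2 ≠ 0) :
    izergin γ m u = symSum γ (fun a => u a - γ / 2) m := by
  have hx : Generic γ fun a => u a - γ / 2 := by simpa [Generic] using hu
  have hfac : ∀ a b, izerginFactor γ (u a - γ / 2) (m b) =
      (u a - m b - γ / 2) * (u a - m b + γ / 2) := fun a b => by rw [izerginFactor]; ring
  have hminj : Function.Injective m := fun a b hab => by
    by_contra hne
    exact hm a b hne (sub_eq_zero.2 hab)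
  have key := izergin_det_eq_symSum _ m hx hminj fun a b => by
    rw [hfac]; exact mul_ne_zero (h1 a b) (h2 a b)
  simp only [hfac, sub_sub_sub_cancel_right] at key
  have hne : ∏ a, ∏ b ∈ Ioi a, ((u b - u a) * (m a - m b)) ≠ 0 :=
    prod_ne_zero_iff.2 fun a _ => prod_ne_zero_iff.2 fun b hb =>
      mul_ne_zero (hu.1 _ _ (mem_Ioi.1 hb).ne') (hm _ _ (mem_Ioi.1 hb).ne)
  rw [izergin, div_mul_eq_mul_div, div_eq_iff hne, key]
  simp only [prod_mul_distrib]

end OrbifoldDefect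

theorem mainTheorem4 (L : ℕ) (γ : ℂ) (u m : Fin L → ℂ)
    (hu : ∀ a b, a ≠ b → u a - u b ≠ 0)
    (huγ : ∀ a b, a ≠ b → u a - u b + γ ≠ 0) :
    ((∀ a b, a ≠ b → m a - m b ≠ 0) →
      (∀ a b, u a - m b - γ / 2 ≠ 0) → (∀ a b, u a - m b + γ / 2 ≠ 0) →
        OrbifoldDefect.zHat γ m u = OrbifoldDefect.izergin γ m u) ∧
    ((∀ a b, u a - m b + γ / 2 ≠ 0) →
      (-γ) ^ L * OrbifoldDefect.zHat γ m u = OrbifoldDefect.kostov γ m u) ∧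
    γ ^ L * OrbifoldDefect.zHat γ m u =
      OrbifoldDefect.dwpf γ (fun a => u a - γ / 2) m := by
  have hgen : OrbifoldDefect.Generic γ u := ⟨hu, huγ⟩
  have hx : OrbifoldDefect.Generic γ fun a => u a - γ / 2 := by
    simpa [OrbifoldDefect.Generic] using hgen
  rw [OrbifoldDefect.zHat_eq_symSum hgen]
  refine ⟨fun hm h1 h2 => (OrbifoldDefect.izergin_eq_symSum hgen hm h1 h2).symm, fun h => ?_, ?_⟩
  · rw [OrbifoldDefect.kostov_eq_kostovQuotient m u h,
      OrbifoldDefect.kostovQuotient_eq_symSum _ m hx]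
  · exact (OrbifoldDefect.dwpf_eq_symSum _ m hx).symm
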